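/- Let $X$ be a real reflexive Banach space and let $P\subset X$ be a cone, i.e. a closed convex set with $\lambda x\in P$ for all $x\in P$, $\lambda\ge 0$, and $P\cap(-P)=\{0\}$. For $\mu>0$ put $D^{\pm}(\mu)=\{x\in X:\operatorname{dist}(x,\pm P)\le\mu\}$. Let $J:X\to\mathbb R$ be locally Lipschitz, with Clarke directional derivative $J^0(x;h)=\limsup_{x'\to x,\ t\downarrow 0}\frac{J(x'+th)-J(x')}{t}$ and Clarke subdifferential $\partial J(x)=\{x^*\in X^*:\langle x^*,h\rangle\le J^0(x;h)\ \forall h\in X\}$. A point $x$ is critical if $0\in\partial J(x)$, and it is a sign-changing critical point if moreover $x\notin P\cup(-P)$. Put $\nabla J(x)=\{y\in X:\ \langle x^*,y\rangle=\|x^*\|^2=\|y\|^2\text{ for some }x^*\in\partial J(x)\}$. For $D\subset X$ and $x\in D$ let $$m_D(x)=\inf_{x^*\in\partial J(x)}\ \sup\{\langle x^*,x-y\rangle: y\in D,\ \|x-y\|<1\}.$$ For $D_1\subset D$ say that $(PS)_{D,D_1}$ holds if every sequence $(x_n)$ in $D_1$ such that $J(x_n)$ converges in $\mathbb R$ and $(1+\|x_n\|)\,m_D(x_n)\to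 0$ has a convergent subsequence; write $(PS)_{D_1}$ for $(PS)_{X,D_1}$. Let $0<\mu_0<1$ and assume: (H1) $x-y\in D^{\pm}(\tfrac12\mu_0)$ for all $x\in\partial D^{\pm}(\mu_0)$ and $y\in\nabla J(x)$ (for each of the two signs); (H2) $J$ satisfies $(PS)_X$, $(PS)_{D^+(\mu_0),D^+(\frac34\mu_0)}$, $(PS)_{D^-(\mu_0),D^-(\frac34\mu_0)}$ and $(PS)_{D^+(\mu_0)\cap D^-(\mu_0)}$. Let $W=D^+(\mu_0)\cup D^-(\mu_0)$ and $S=X\setminus W$. Let $Q\subset X$ be compact, $T\subset S$ closed, and let $\partial Q$ denote a given closed subset of $Q$ (its boundary, for instance its relative boundary in its affine span). Suppose that $(Q,T)$ is linking: $\partial Q\cap T=\emptyset$, and $\gamma(Q)\cap T\ne\emptyset$ for every continuous $\gamma:Q\to X$ with $\gamma(x)=x$ for all $x\in\partial Q$. Let $\alpha<\beta$ be real numbers with $$J\le\alpha\ \text{ on }\partial Q\cap S,\qquad J\ge\beta\ \text{ on }T,$$ and let $$\Gamma=\{\gamma\in C(Q,X):\ \gamma(x)=x\ \text{ for }x\in\partial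 Q\cap S,\ \ \gamma(\partial Q\cap W)\subset W\},\qquad r=\inf_{\gamma\in\Gamma}\ \sup_{\gamma(Q)\cap S}J .$$ Then $r$ is a real number, $r\ge\beta$, and there is $x\in S$ with $J(x)=r$ and $0\in\partial J(x)$; in particular $x$ is a sign-changing critical point of $J$. -/

import Mathlib

open Filter Topology Set
open scoped Pointwise

noncomputable section

variable {X : Type*} [NormedAddCommGroup X] [NormedSpace ℝ X]

/-- Reflexivity: the canonical embedding of `X` into its bidual is onto. -/
def IsReflexiveSpace (X : Type*) [NormedAddCommGroup X] [NormedSpace ℝ X] : Prop :=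
  Function.Surjective (NormedSpace.inclusionInDoubleDual ℝ X)

/-- Clarke's generalized directional derivative
`φ⁰(x; h) = limsup_{x' → x, t ↓ 0} (φ (x' + t h) - φ x') / t`
(a finite upper limit when `φ` is locally Lipschitz). -/
def clarkeDeriv (φ : X → ℝ) (x h : X) : ℝ :=
  limsup (fun p : X × ℝ => (φ (p.1 + p.2 • h) - φ p.1) / p.2) (𝓝 x ×ˢ 𝓝[>] (0 : ℝ))

/-- The Clarke subdifferential (generalized gradient) of `φ` at `x`. -/
def clarkeSubdifferential (φ : X → ℝ) (x : X) : Set (StrongDual ℝ X) :=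
  {f | ∀ h : X, f h ≤ clarkeDeriv φ x h}

/-- `x` is a critical point of `φ`. -/
def IsCriticalPoint (φ : X → ℝ) (x : X) : Prop :=
  (0 : StrongDual ℝ X) ∈ clarkeSubdifferential φ x

/-- The generalized slope of `φ` on the set `D` at `x`:
`m_D(x) = inf_{f ∈ ∂φ(x)} sup {⟨f, x - y⟩ : y ∈ D, ‖x - y‖ < 1}`.
For locally Lipschitz `φ` and `x ∈ D` the set `∂φ(x)` is non-empty and each supremum lies between
`0` and `‖f‖`, so no degenerate value of `sInf` or `sSup` occurs. -/
def slopeOn (φ : X → ℝ) (D : Set X) (x : X) : ℝ :=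
  sInf ((fun f : StrongDual ℝ X => sSup ((fun y : X => f (x - y)) '' {y ∈ D | ‖x - y‖ < 1})) ''
    clarkeSubdifferential φ x)

/-- The nonsmooth Cerami condition on `D₁` with respect to `D`, at every level. -/
def CeramiCondition (φ : X → ℝ) (D D₁ : Set X) : Prop :=
  ∀ (r : ℝ) (u : ℕ → X), (∀ n, u n ∈ D₁) → Tendsto (fun n => φ (u n)) atTop (𝓝 r) →
    Tendsto (fun n => (1 + ‖u n‖) * slopeOn φ D (u n)) atTop (𝓝 0) →
    ∃ (a : X) (k : ℕ → ℕ), StrictMono k ∧ Tendsto (fun n => u (k n)) atTop (𝓝 a)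

/-- The duality map from the dual into subsets of `X` (with `X` identified with its bidual):
`F(f) = {x : ⟨f, x⟩ = ‖f‖² = ‖x‖²}`. -/
def dualityMap (f : StrongDual ℝ X) : Set X :=
  {x | f x = ‖f‖ ^ 2 ∧ ‖f‖ ^ 2 = ‖x‖ ^ 2}

/-- The set-valued gradient `∇φ(x) = F(∂φ(x))`. -/
def setGradient (φ : X → ℝ) (x : X) : Set X :=
  ⋃ f ∈ clarkeSubdifferential φ x, dualityMap f

/-- A cone: closed, convex, stable under non-negative multiples, with `P ∩ (-P) = {0}`. -/
structure IsOrderCone (P : Set X) : Prop where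
  isClosed : IsClosed P
  convex : Convex ℝ P
  smul_mem : ∀ x ∈ P, ∀ t : ℝ, 0 ≤ t → t • x ∈ P
  inter_neg : P ∩ (-P) = {0}

/-- A sign-changing critical point: a critical point outside `P ∪ (-P)`. -/
def IsSignChangingCriticalPoint (P : Set X) (φ : X → ℝ) (x : X) : Prop :=
  IsCriticalPoint φ x ∧ x ∉ P ∪ (-P)

/-- The closed `μ`-neighbourhood of a (non-empty) set: `D⁺(μ) = coneNhd P μ`,
`D⁻(μ) = coneNhd (-P) μ`. -/
def coneNhd (P : Set X) (μ : ℝ) : Set X := {x | Metric.infDist x P ≤ μ}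

/-- The condition `(I - ∇J)(∂D^±(μ)) ⊆ D^±(μ/2)`. -/
def InvarianceCondition (P : Set X) (J : X → ℝ) (μ : ℝ) : Prop :=
  (∀ x ∈ frontier (coneNhd P μ), ∀ y ∈ setGradient J x, x - y ∈ coneNhd P (μ / 2)) ∧
  (∀ x ∈ frontier (coneNhd (-P) μ), ∀ y ∈ setGradient J x, x - y ∈ coneNhd (-P) (μ / 2))

/-- The four Cerami conditions. The last two arguments are `D` and `D₁`. -/
def CompactnessCondition (P : Set X) (J : X → ℝ) (μ : ℝ) : Prop :=
  CeramiCondition J univ univ ∧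
  CeramiCondition J (coneNhd P μ) (coneNhd P (3 / 4 * μ)) ∧
  CeramiCondition J (coneNhd (-P) μ) (coneNhd (-P) (3 / 4 * μ)) ∧
  CeramiCondition J univ (coneNhd P μ ∩ coneNhd (-P) μ)

/-- `(Q, T)` is linking, where the (relative) boundary of `Q` is the closed subset `bQ` of `Q`:
`bQ` misses `T`, and the image of every continuous map `Q → X` that fixes `bQ` pointwise
meets `T`. -/
structure IsLinking (Q bQ T : Set X) : Prop where
  isClosed_left : IsClosed Q
  isClosed_right : IsClosed T
  isClosed_boundary : IsClosed bQ
  boundary_subset : bQ ⊆ Q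
  boundary_inter : bQ ∩ T = ∅
  meets : ∀ γ : C(Q, X), (∀ q : Q, (q : X) ∈ bQ → γ q = q) → (range γ ∩ T).Nonempty

/-- The class `Γ` of continuous maps `γ : Q → X` that are the identity on `∂Q ∩ (X ∖ W)` and map
`∂Q ∩ W` into `W`. -/
def admissibleMaps (Q bQ W : Set X) : Set C(Q, X) :=
  {γ | (∀ q : Q, (q : X) ∈ bQ ∩ Wᶜ → γ q = q) ∧ (∀ q : Q, (q : X) ∈ bQ ∩ W → γ q ∈ W)}

/-- The minimax level `inf_{γ ∈ Γ} sup_{γ(Q) ∩ (X ∖ W)} J`, as an extended real number. -/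
def minimaxLevel (J : X → ℝ) (Q bQ W : Set X) : EReal :=
  ⨅ γ ∈ admissibleMaps Q bQ W, ⨆ x ∈ range γ ∩ Wᶜ, (J x : EReal)

end

/-!
Let `W` be the union of the convex sets `D⁺(μ₀)` and `D⁻(μ₀)`. The argument is a minimax argument
relative to `W`, with Ekeland's principle in place of a deformation flow, so that a single small
step of a vector field suffices and no differential equation has to be solved.

*The level.* Each admissible map `γ` meets `T`: since `W` is star-shaped about `0`, the values of
`γ` on the boundary can be pulled back to the identity without touching `T`
(`IsLinking.exists_mem_of_admissible`). Hence the minimax level `r` is finite and `r ≥ β > α`.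

*Descent.* If all subgradients at `x` are large, then a convexity argument of Mazur–Orlicz type
(`exists_dual_le_sublinear`) yields one direction in which `J` decreases at a definite rate. On the
frontier of `D = D^±(μ₀)` the invariance condition says that `x - y` lies in the interior of `D`
for all gradients `y`, so the direction can also be chosen to point into `D`
(`LocallyLipschitz.exists_descent_direction`). Nothing is asked in the interior of `W`, where `J`
is not controlled. Finitely many such steps, weighted by bump functions, move an admissible map to
an admissible map with a smaller maximum outside `W` (`exists_deformed_map`).

*Cerami sequence.* Ekeland's principle is applied to `γ ↦ sup_{γ(Q) ∖ W} J`, in a complete metric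
for which a displacement of `x` by `h` costs about `‖h‖ / (1 + ‖x‖)` (`ceramiChart`). Its almost
minimizers cannot be improved by a descent step, so they carry points `x` outside the interior of
`W` with `J x` close to `r` and a subgradient `f` with `(1 + ‖x‖) ‖f‖` small
(`LocallyLipschitz.exists_almost_critical`). The Cerami condition on the whole space gives a limit,
which is critical; it is not on the frontier of `W`, since a critical point on the frontier of `D`
has `0` as a gradient and would be an interior point of `D`.
-/

noncomputable section

variable {X : Type*} [NormedAddCommGroup X] [NormedSpace ℝ X]

/-! ### Clarke's directional derivative -/

section Clarke

variable {J : X → ℝ}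

lemma tendsto_add_smul_of_clarke (x h : X) :
    Tendsto (fun p : X × ℝ => p.1 + p.2 • h) (𝓝 x ×ˢ 𝓝[>] (0 : ℝ)) (𝓝 x) := by
  have h2 : Tendsto (fun p : X × ℝ => p.2) (𝓝 x ×ˢ 𝓝[>] (0 : ℝ)) (𝓝 0) :=
    tendsto_snd.mono_right nhdsWithin_le_nhds
  simpa using tendsto_fst.add (h2.smul_const h)

lemma eventually_snd_pos_of_clarke {E : Type*} [TopologicalSpace E] (x : E) :
    ∀ᶠ p : E × ℝ in 𝓝 x ×ˢ 𝓝[>] (0 : ℝ), 0 < p.2 :=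
  tendsto_snd.eventually self_mem_nhdsWithin

lemma LocallyLipschitz.exists_abs_diffQuot_le (hJ : LocallyLipschitz J) (x : X) :
    ∃ K : ℝ, 0 ≤ K ∧ ∀ h : X, ∀ᶠ p : X × ℝ in 𝓝 x ×ˢ 𝓝[>] (0 : ℝ),
      |(J (p.1 + p.2 • h) - J p.1) / p.2| ≤ K * ‖h‖ := by
  obtain ⟨K, t, ht, hK⟩ := hJ x
  refine ⟨K, K.2, fun h => ?_⟩
  filter_upwards [(tendsto_add_smul_of_clarke x h).eventually ht,
    (tendsto_fst : Tendsto Prod.fst (𝓝 x ×ˢ 𝓝[>] (0 : ℝ)) (𝓝 x)).eventually ht,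
    eventually_snd_pos_of_clarke x] with p h1 h2 h3
  have := hK.dist_le_mul _ h1 _ h2
  rw [Real.dist_eq, dist_eq_norm, add_sub_cancel_left, norm_smul, Real.norm_of_nonneg h3.le] at this
  rw [abs_div, abs_of_pos h3, div_le_iff₀ h3]
  linarith

lemma LocallyLipschitz.eventually_diffQuot_lt (hJ : LocallyLipschitz J) {x h : X} {c : ℝ}
    (hc : clarkeDeriv J x h < c) :
    ∀ᶠ p : X × ℝ in 𝓝 x ×ˢ 𝓝[>] (0 : ℝ), (J (p.1 + p.2 • h) - J p.1) / p.2 < c := by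
  obtain ⟨K, -, hK⟩ := hJ.exists_abs_diffQuot_le x
  exact eventually_lt_of_limsup_lt hc
    ⟨K * ‖h‖, eventually_map.2 ((hK h).mono fun p hp => (abs_le.1 hp).2)⟩

lemma LocallyLipschitz.clarkeDeriv_le (hJ : LocallyLipschitz J) {x h : X} {c : ℝ}
    (hc : ∀ᶠ p : X × ℝ in 𝓝 x ×ˢ 𝓝[>] (0 : ℝ), (J (p.1 + p.2 • h) - J p.1) / p.2 ≤ c) :
    clarkeDeriv J x h ≤ c := by
  obtain ⟨K, -, hK⟩ := hJ.exists_abs_diffQuot_le x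
  refine limsup_le_of_le (IsBoundedUnder.isCoboundedUnder_le ⟨-(K * ‖h‖), ?_⟩) hc
  exact eventually_map.2 ((hK h).mono fun p hp => (abs_le.1 hp).1)

lemma LocallyLipschitz.exists_clarkeDeriv_le_mul_norm (hJ : LocallyLipschitz J) (x : X) :
    ∃ K : ℝ, 0 ≤ K ∧ ∀ h : X, clarkeDeriv J x h ≤ K * ‖h‖ := by
  obtain ⟨K, h0, hK⟩ := hJ.exists_abs_diffQuot_le x
  exact ⟨K, h0, fun h => hJ.clarkeDeriv_le ((hK h).mono fun p hp => (abs_le.1 hp).2)⟩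

lemma LocallyLipschitz.clarkeDeriv_add_le (hJ : LocallyLipschitz J) (x h k : X) :
    clarkeDeriv J x (h + k) ≤ clarkeDeriv J x h + clarkeDeriv J x k := by
  refine le_of_forall_pos_le_add fun ε hε => ?_
  have h1 := hJ.eventually_diffQuot_lt (show clarkeDeriv J x h < clarkeDeriv J x h + ε / 2 by
    linarith)
  have h2 := hJ.eventually_diffQuot_lt (show clarkeDeriv J x k < clarkeDeriv J x k + ε / 2 by
    linarith)
  have h3 : Tendsto (fun p : X × ℝ => (p.1 + p.2 • h, p.2)) (𝓝 x ×ˢ 𝓝[>] (0 : ℝ))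
      (𝓝 x ×ˢ 𝓝[>] (0 : ℝ)) := (tendsto_add_smul_of_clarke x h).prodMk tendsto_snd
  refine hJ.clarkeDeriv_le ?_
  filter_upwards [h1, h3.eventually h2] with p hp hq
  have e : (J (p.1 + p.2 • (h + k)) - J p.1) / p.2 =
      (J (p.1 + p.2 • h) - J p.1) / p.2 +
        (J (p.1 + p.2 • h + p.2 • k) - J (p.1 + p.2 • h)) / p.2 := by
    rw [smul_add, add_assoc]; ring
  rw [e]
  linarith

lemma LocallyLipschitz.clarkeDeriv_smul_le (hJ : LocallyLipschitz J) (x h : X) {s : ℝ}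
    (hs : 0 < s) : clarkeDeriv J x (s • h) ≤ s * clarkeDeriv J x h := by
  refine le_of_forall_pos_le_add fun ε hε => ?_
  have h1 := hJ.eventually_diffQuot_lt (show clarkeDeriv J x h < clarkeDeriv J x h + ε / s by
    have := div_pos hε hs
    linarith)
  have h2 : Tendsto (fun t : ℝ => t * s) (𝓝[>] 0) (𝓝[>] 0) := by
    refine tendsto_nhdsWithin_iff.2 ⟨?_, ?_⟩
    · have : Tendsto (fun t : ℝ => t * s) (𝓝 0) (𝓝 (0 * s)) := tendsto_id.mul_const s
      rw [zero_mul] at this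
      exact this.mono_left nhdsWithin_le_nhds
    · filter_upwards [self_mem_nhdsWithin] with t ht using mul_pos ht hs
  have h3 : Tendsto (fun p : X × ℝ => (p.1, p.2 * s)) (𝓝 x ×ˢ 𝓝[>] (0 : ℝ))
      (𝓝 x ×ˢ 𝓝[>] (0 : ℝ)) := tendsto_fst.prodMk (h2.comp tendsto_snd)
  refine hJ.clarkeDeriv_le ?_
  filter_upwards [h3.eventually h1, eventually_snd_pos_of_clarke x] with p hp hp0
  have e : (J (p.1 + p.2 • (s • h)) - J p.1) / p.2 =
      s * ((J (p.1 + (p.2 * s) • h) - J p.1) / (p.2 * s)) := by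
    rw [smul_smul]; field_simp
  rw [e]
  calc _ ≤ s * (clarkeDeriv J x h + ε / s) := by gcongr
    _ = _ := by field_simp

lemma LocallyLipschitz.continuous_clarkeDeriv (hJ : LocallyLipschitz J) (x : X) :
    Continuous (clarkeDeriv J x) := by
  obtain ⟨K, h0, hK⟩ := hJ.exists_clarkeDeriv_le_mul_norm x
  refine (LipschitzWith.of_dist_le_mul (K := ⟨K, h0⟩) fun h k => ?_).continuous
  have key : ∀ a b : X, clarkeDeriv J x a - clarkeDeriv J x b ≤ K * ‖a - b‖ := fun a b => by
    have := hJ.clarkeDeriv_add_le x (a - b) b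
    rw [sub_add_cancel] at this
    linarith [hK (a - b)]
  rw [Real.dist_eq, dist_eq_norm, abs_le]
  have h1 := key h k
  have h2 := key k h
  rw [norm_sub_rev] at h2
  change -(K * ‖h - k‖) ≤ _ ∧ _ ≤ K * ‖h - k‖
  constructor <;> linarith

/-- Upper semicontinuity of `x ↦ J⁰(x; h)`. -/
lemma LocallyLipschitz.eventually_clarkeDeriv_le (hJ : LocallyLipschitz J) {x h : X} {c : ℝ}
    (hc : clarkeDeriv J x h < c) : ∀ᶠ z in 𝓝 x, clarkeDeriv J z h ≤ c := by
  obtain ⟨U, hU, V, hV, hUV⟩ := eventually_prod_iff.1 (hJ.eventually_diffQuot_lt hc)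
  filter_upwards [hU.eventually_nhds] with z hz
  exact hJ.clarkeDeriv_le ((hz.prod_mk hV).mono fun p hp => (hUV hp.1 hp.2).le)

/-- The graph of the subdifferential is closed at the zero functional: a limit of points carrying
subgradients that tend to zero is critical. -/
lemma LocallyLipschitz.isCriticalPoint_of_tendsto (hJ : LocallyLipschitz J) {u : ℕ → X} {a : X}
    {f : ℕ → StrongDual ℝ X} (hu : Tendsto u atTop (𝓝 a))
    (hf : ∀ n, f n ∈ clarkeSubdifferential J (u n)) (hf0 : Tendsto f atTop (𝓝 0)) :
    IsCriticalPoint J a := by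
  intro h
  rw [_root_.zero_apply]
  refine le_of_forall_gt_imp_ge_of_dense fun c hc => ?_
  have h1 := hu.eventually (hJ.eventually_clarkeDeriv_le hc)
  have h2 : Tendsto (fun n => f n h) atTop (𝓝 0) := by
    have := ((ContinuousLinearMap.apply ℝ ℝ h).continuous.tendsto 0).comp hf0
    rwa [map_zero] at this
  exact le_of_tendsto h2 (h1.mono fun n hn => (hf n h).trans hn)

lemma slopeOn_univ_mem_Icc {x : X} {f : StrongDual ℝ X}
    (hf : f ∈ clarkeSubdifferential J x) : slopeOn J univ x ∈ Icc 0 ‖f‖ := by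
  have hb : ∀ g : StrongDual ℝ X, ∀ z ∈ (fun y : X => g (x - y)) '' {y ∈ univ | ‖x - y‖ < 1},
      z ≤ ‖g‖ := by
    rintro g _ ⟨y, hy, rfl⟩
    calc g (x - y) ≤ ‖g (x - y)‖ := Real.le_norm_self _
      _ ≤ ‖g‖ * ‖x - y‖ := g.le_opNorm _
      _ ≤ ‖g‖ * 1 := by gcongr; exact hy.2.le
      _ = ‖g‖ := mul_one _
  have h0 : ∀ g : StrongDual ℝ X,
      (0 : ℝ) ∈ (fun y : X => g (x - y)) '' {y ∈ univ | ‖x - y‖ < 1} :=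
    fun g => ⟨x, by simp, by simp⟩
  have hpos : ∀ z ∈ (fun f : StrongDual ℝ X =>
      sSup ((fun y : X => f (x - y)) '' {y ∈ univ | ‖x - y‖ < 1})) '' clarkeSubdifferential J x,
      0 ≤ z := by
    rintro _ ⟨g, -, rfl⟩
    exact le_csSup ⟨_, hb g⟩ (h0 g)
  exact ⟨Real.sInf_nonneg hpos,
    (csInf_le ⟨0, hpos⟩ ⟨f, hf, rfl⟩).trans (csSup_le ⟨0, h0 f⟩ (hb f))⟩

end Clarke

/-! ### Convex duality -/

/-- A form of the Mazur–Orlicz theorem: a lower bound on a convex set for a continuous sublinear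
functional is inherited by a linear functional below it. -/
lemma exists_dual_le_sublinear {p : X → ℝ} (hp : Continuous p)
    (hadd : ∀ h k, p (h + k) ≤ p h + p k) (hsmul : ∀ (h : X) {s : ℝ}, 0 < s → p (s • h) ≤ s * p h)
    {C : Set X} (hC : Convex ℝ C) (hne : C.Nonempty) {c : ℝ} (hcC : ∀ v ∈ C, c ≤ p v) :
    ∃ f : StrongDual ℝ X, (∀ h, f h ≤ p h) ∧ ∀ v ∈ C, c ≤ f v := by
  have hp0 : p 0 = 0 := by
    have h1 := hadd 0 0
    have h2 := hsmul 0 (s := 1 / 2) (by norm_num)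
    simp only [add_zero, smul_zero] at h1 h2
    linarith
  -- Separate the strict epigraph of `p` from `C × {c}`.
  obtain ⟨F, u, hF1, hF2⟩ := geometric_hahn_banach_open
    (s := {z : X × ℝ | p z.1 < z.2}) (t := C ×ˢ {c})
    (by
      rw [convex_iff_forall_pos]
      rintro ⟨a, s⟩ ha ⟨b, t⟩ hb α β hα hβ -
      simp only [mem_ofPred_eq] at ha hb ⊢
      calc p (α • a + β • b) ≤ α * p a + β * p b :=
            (hadd _ _).trans (add_le_add (hsmul a hα) (hsmul b hβ))
        _ < α * s + β * t := by gcongr)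
    (isOpen_lt (hp.comp continuous_fst) continuous_snd)
    (hC.prod (convex_singleton c))
    (by
      rw [Set.disjoint_left]
      rintro ⟨a, s⟩ h1 ⟨h2, h3⟩
      simp only [mem_singleton_iff, mem_ofPred_eq] at h1 h2 h3
      subst h3
      exact (h1.trans_le (hcC a h2)).false)
  set g : StrongDual ℝ X := F.comp (ContinuousLinearMap.inl ℝ X ℝ) with hg
  set κ : ℝ := F (0, 1) with hκ
  have hFg : ∀ (h : X) (s : ℝ), F (h, s) = g h + s * κ := fun h s => by
    have : ((h, s) : X × ℝ) = (h, 0) + s • ((0 : X), (1 : ℝ)) := by simp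
    rw [this, map_add, map_smul, hg, hκ]
    simp
  have h1 : ∀ (h : X) (s : ℝ), p h < s → g h + s * κ < u := fun h s hs => by
    rw [← hFg]; exact hF1 (h, s) hs
  have h2 : ∀ v ∈ C, u ≤ g v + c * κ := fun v hv => by
    rw [← hFg]; exact hF2 (v, c) ⟨hv, rfl⟩
  have hκ0 : κ < 0 := by
    obtain ⟨v, hv⟩ := hne
    have a1 := h1 v (p v + 1) (by linarith)
    have a2 := h2 v hv
    have a3 := hcC v hv
    by_contra! hcon
    nlinarith
  have h3 : ∀ h : X, g h + p h * κ ≤ u := fun h => by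
    refine le_of_forall_pos_le_add fun ε hε => ?_
    have := h1 h (p h + ε / (-κ)) (by have := div_pos hε (neg_pos.2 hκ0); linarith)
    have e : ε / (-κ) * κ = -ε := by rw [div_neg, neg_mul, div_mul_cancel₀ _ hκ0.ne]
    rw [add_mul, e] at this
    linarith
  have hu : 0 ≤ u := by simpa [hp0] using h3 0
  have h4 : ∀ h : X, g h + p h * κ ≤ 0 := fun h => by
    by_contra! hcon
    have hs : 0 < (u + 1) / (g h + p h * κ) := by positivity
    have a1 := h3 (((u + 1) / (g h + p h * κ)) • h)
    have a2 := mul_le_mul_of_nonpos_right (hsmul h hs) hκ0.le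
    rw [map_smul, smul_eq_mul] at a1
    have a3 : (u + 1) / (g h + p h * κ) * g h + (u + 1) / (g h + p h * κ) * p h * κ = u + 1 := by
      field_simp
    linarith
  refine ⟨(-κ)⁻¹ • g, fun h => ?_, fun v hv => ?_⟩
  · rw [_root_.smul_apply, smul_eq_mul, inv_mul_le_iff₀ (neg_pos.2 hκ0)]
    linarith [h4 h]
  · rw [_root_.smul_apply, smul_eq_mul, le_inv_mul_iff₀ (neg_pos.2 hκ0)]
    linarith [h2 v hv]

lemma LocallyLipschitz.exists_mem_clarkeSubdifferential {J : X → ℝ} (hJ : LocallyLipschitz J)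
    (x : X) {C : Set X} (hC : Convex ℝ C) (hne : C.Nonempty) {c : ℝ}
    (hcC : ∀ v ∈ C, c ≤ clarkeDeriv J x v) :
    ∃ f ∈ clarkeSubdifferential J x, ∀ v ∈ C, c ≤ f v :=
  exists_dual_le_sublinear (hJ.continuous_clarkeDeriv x) (hJ.clarkeDeriv_add_le x)
    (fun h _ hs => hJ.clarkeDeriv_smul_le x h hs) hC hne hcC

lemma LocallyLipschitz.clarkeSubdifferential_nonempty {J : X → ℝ} (hJ : LocallyLipschitz J)
    (x : X) : (clarkeSubdifferential J x).Nonempty := by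
  obtain ⟨f, hf, -⟩ := hJ.exists_mem_clarkeSubdifferential x (convex_singleton (0 : X))
    (singleton_nonempty _) (c := clarkeDeriv J x 0) (by simp)
  exact ⟨f, hf⟩

/-- On a reflexive space every functional attains its norm. -/
lemma IsReflexiveSpace.dualityMap_nonempty (hX : IsReflexiveSpace X) (f : StrongDual ℝ X) :
    (dualityMap f).Nonempty := by
  rcases eq_or_ne f 0 with rfl | hf
  · exact ⟨0, by simp [dualityMap]⟩
  obtain ⟨φ, hφ1, hφ2⟩ := exists_dual_vector ℝ f (norm_ne_zero_iff.2 hf)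
  obtain ⟨y, rfl⟩ := hX φ
  have hy : ‖y‖ = 1 := by
    rw [← hφ1]; exact ((NormedSpace.inclusionInDoubleDualLi ℝ).norm_map y).symm
  refine ⟨‖f‖ • y, ?_, ?_⟩
  · rw [NormedSpace.dual_def] at hφ2
    rw [map_smul, hφ2]
    simp [sq]
  · simp [norm_smul, hy]

/-! ### Ekeland's variational principle -/

/-- Ekeland's variational principle (weak form): a lower semicontinuous function that is bounded
below has, below any given point, a minimizer up to the perturbation `ε * dist`. -/
lemma LowerSemicontinuous.exists_le_add_mul_dist {Z : Type*} [PseudoMetricSpace Z]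
    [CompleteSpace Z] {Φ : Z → ℝ} (hΦ : LowerSemicontinuous Φ) {r : ℝ} (hr : ∀ z, r ≤ Φ z)
    {ε : ℝ} (hε : 0 < ε) (z₀ : Z) :
    ∃ z, Φ z ≤ Φ z₀ ∧ ∀ w, Φ z ≤ Φ w + ε * dist w z := by
  set S : Z → Set Z := fun z => {w | Φ w + ε * dist w z ≤ Φ z} with hS
  have hself : ∀ z, z ∈ S z := fun z => by simp [hS]
  have htrans : ∀ {u v w : Z}, v ∈ S u → w ∈ S v → w ∈ S u := by
    intro u v w hv hw
    simp only [hS, mem_ofPred_eq] at hv hw ⊢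
    have := mul_le_mul_of_nonneg_left (dist_triangle w v u) hε.le
    linarith
  have hclosed : ∀ z, IsClosed (S z) := fun z => by
    have : LowerSemicontinuous fun w => Φ w + ε * dist w z :=
      hΦ.add (Continuous.lowerSemicontinuous (by fun_prop))
    exact this.isClosed_preimage (Φ z)
  have hstep : ∀ (n : ℕ) (z : Z), ∃ w ∈ S z, ∀ v ∈ S z, Φ w ≤ Φ v + 1 / ((n : ℝ) + 1) := by
    intro n z
    have hne : (Φ '' S z).Nonempty := ⟨_, z, hself z, rfl⟩
    have hbdd : BddBelow (Φ '' S z) := ⟨r, by rintro _ ⟨w, -, rfl⟩; exact hr w⟩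
    obtain ⟨_, ⟨w, hw, rfl⟩, hlt⟩ := exists_lt_of_csInf_lt hne
      (lt_add_of_pos_right (sInf (Φ '' S z)) (Nat.one_div_pos_of_nat (α := ℝ) (n := n)))
    exact ⟨w, hw, fun v hv => hlt.le.trans (by gcongr; exact csInf_le hbdd ⟨v, hv, rfl⟩)⟩
  choose next hnext hmin using hstep
  set u : ℕ → Z := fun n => Nat.rec z₀ next n with hu
  have hu1 : ∀ n, u (n + 1) = next n (u n) := fun n => rfl
  have hmem : ∀ n k, u (n + k) ∈ S (u n) := by
    intro n k
    induction k with
    | zero => exact hself _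
    | succ k ih => exact htrans ih (by rw [← add_assoc, hu1]; exact hnext _ _)
  have hanti : Antitone fun n => Φ (u n) := antitone_nat_of_succ_le fun n => by
    have h1 : Φ (u (n + 1)) + ε * dist (u (n + 1)) (u n) ≤ Φ (u n) := hmem n 1
    have h2 : 0 ≤ ε * dist (u (n + 1)) (u n) := by positivity
    linarith
  obtain ⟨L, hL⟩ : ∃ L, Tendsto (fun n => Φ (u n)) atTop (𝓝 L) :=
    ⟨_, tendsto_atTop_ciInf hanti ⟨r, by rintro _ ⟨n, rfl⟩; exact hr _⟩⟩
  have hLle : ∀ n, L ≤ Φ (u n) := fun n => hanti.le_of_tendsto hL n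
  have hcauchy : CauchySeq u := by
    refine cauchySeq_of_le_tendsto_0' (fun n => (Φ (u n) - L) / ε) (fun n m hnm => ?_) ?_
    · obtain ⟨k, rfl⟩ := Nat.exists_eq_add_of_le hnm
      have h1 : Φ (u (n + k)) + ε * dist (u (n + k)) (u n) ≤ Φ (u n) := hmem n k
      rw [le_div_iff₀ hε, dist_comm]
      linarith [hLle (n + k)]
    · simpa using (hL.sub_const L).div_const ε
  obtain ⟨z, hz⟩ := cauchySeq_tendsto_of_complete hcauchy
  have hzS : ∀ n, z ∈ S (u n) := fun n =>
    (hclosed (u n)).mem_of_tendsto ((tendsto_add_atTop_iff_nat n).2 hz)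
      (Eventually.of_forall fun k => by rw [add_comm]; exact hmem n k)
  have hle : ∀ n, Φ z ≤ Φ (u n) := fun n => by
    have h1 : Φ z + ε * dist z (u n) ≤ Φ (u n) := hzS n
    have h2 : 0 ≤ ε * dist z (u n) := by positivity
    linarith
  refine ⟨z, hle 0, fun w => ?_⟩
  by_contra! hcon
  have hw : w ∈ S z := hcon.le
  have h1 : ∀ n : ℕ, Φ z ≤ Φ w + 1 / ((n : ℝ) + 1) := fun n =>
    (hle (n + 1)).trans (hmin n (u n) w (htrans (hzS n) hw))
  have h2 : Φ z ≤ Φ w + 0 :=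
    ge_of_tendsto' (tendsto_const_nhds.add tendsto_one_div_add_atTop_nhds_zero_nat) h1
  have h3 : 0 ≤ ε * dist w z := by positivity
  linarith

/-! ### Linking -/

/-- A linking pair stays linked when the boundary may move inside a closed set `W` that is
star-shaped about the origin and misses `T`. The boundary values are pulled back to the identity:
along `γ q → 0 → q` where `γ q` is far from `q`, and along a segment where it is near. -/
lemma IsLinking.exists_mem_of_admissible {Q bQ T W : Set X} (h : IsLinking Q bQ T)
    (hQ : IsCompact Q) (hWc : IsClosed W) (hWs : ∀ x ∈ W, ∀ s ∈ Icc (0 : ℝ) 1, s • x ∈ W)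
    (hT : T ⊆ Wᶜ) {γ : C(Q, X)} (hγ : γ ∈ admissibleMaps Q bQ W) : ∃ q, γ q ∈ T := by
  have : CompactSpace Q := isCompact_iff_compactSpace.1 hQ
  set A : Set Q := {q | (q : X) ∈ bQ ∩ W} with hA
  have hAc : IsClosed A := (h.isClosed_boundary.inter hWc).preimage continuous_subtype_val
  set C : Set X := (fun z : ℝ × Q => z.1 • γ z.2) '' (Icc 0 1 ×ˢ A) ∪
    (fun z : ℝ × Q => z.1 • (z.2 : X)) '' (Icc 0 1 ×ˢ A) with hC
  have hCc : IsCompact C :=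
    ((isCompact_Icc.prod hAc.isCompact).image (by fun_prop)).union
      ((isCompact_Icc.prod hAc.isCompact).image (by fun_prop))
  have hCW : C ⊆ W := by
    rintro _ (⟨⟨s, q⟩, ⟨hs, hq⟩, rfl⟩ | ⟨⟨s, q⟩, ⟨hs, hq⟩, rfl⟩)
    · exact hWs _ (hγ.2 q hq) s hs
    · exact hWs _ hq.2 s hs
  have hdisj : Disjoint C T := Set.disjoint_left.2 fun x hx hxT => hT hxT (hCW hx)
  obtain ⟨ε, hε, hεd⟩ := hdisj.exists_thickenings hCc h.isClosed_right
  have hfar : ∀ x ∈ C, ∀ y, dist y x < ε → y ∉ T := fun x hx y hyx hyT =>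
    Set.disjoint_left.1 hεd (Metric.mem_thickening_iff.2 ⟨x, hx, hyx⟩)
      (Metric.self_subset_thickening hε _ hyT)
  -- The cut-off `κ` switches between the segment and the path through the origin.
  set κ : Q → ℝ := fun q => min 1 (dist (γ q) (q : X) / ε) with hκ
  have hκ0 : ∀ q, 0 ≤ κ q := fun q => le_min zero_le_one (by positivity)
  have hκ1 : ∀ q, κ q ≤ 1 := fun q => min_le_left _ _
  set a : Q → ℝ → ℝ := fun q t => (1 - κ q) * (1 - t) + κ q * max 0 (1 - 2 * t) with ha
  set b : Q → ℝ → ℝ := fun q t => (1 - κ q) * t + κ q * max 0 (2 * t - 1) with hb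
  set H : Q → ℝ → X := fun q t => a q t • γ q + b q t • (q : X) with hH
  have hκc : Continuous κ := by fun_prop
  have hHc : Continuous fun z : Q × ℝ => H z.1 z.2 := by
    simp only [hH, ha, hb]; fun_prop
  have hHT : ∀ q : Q, (q : X) ∈ bQ → ∀ t ∈ Icc (0 : ℝ) 1, H q t ∉ T := by
    intro q hq t ht
    by_cases hqW : (q : X) ∈ W
    · have hqA : q ∈ A := ⟨hq, hqW⟩
      rcases le_or_gt ε (dist (γ q) (q : X)) with hd | hd
      · have hk : κ q = 1 := min_eq_left (by rwa [le_div_iff₀ hε, one_mul])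
        have hmem : H q t ∈ C := by
          rcases le_total t (1 / 2) with h1 | h1
          · refine Or.inl ⟨(1 - 2 * t, q), ⟨⟨by linarith, by linarith [ht.1]⟩, hqA⟩, ?_⟩
            simp [hH, ha, hb, hk, max_eq_right (show (0 : ℝ) ≤ 1 - 2 * t by linarith),
              max_eq_left (show 2 * t - 1 ≤ (0 : ℝ) by linarith)]
          · refine Or.inr ⟨(2 * t - 1, q), ⟨⟨by linarith, by linarith [ht.2]⟩, hqA⟩, ?_⟩
            simp [hH, ha, hb, hk, max_eq_right (show (0 : ℝ) ≤ 2 * t - 1 by linarith),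
              max_eq_left (show 1 - 2 * t ≤ (0 : ℝ) by linarith)]
        exact hfar _ hmem _ (by simpa using hε)
      · have ha0 : 0 ≤ a q t := add_nonneg
          (mul_nonneg (by linarith [hκ1 q]) (by linarith [ht.2]))
          (mul_nonneg (hκ0 q) (le_max_left _ _))
        have hb0 : 0 ≤ b q t := add_nonneg
          (mul_nonneg (by linarith [hκ1 q]) ht.1) (mul_nonneg (hκ0 q) (le_max_left _ _))
        have hab : a q t + b q t ≤ 1 := by
          have h1 : max 0 (1 - 2 * t) + max 0 (2 * t - 1) ≤ 1 := by
            rcases le_total t (1 / 2) with h1 | h1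
            · rw [max_eq_right (by linarith), max_eq_left (by linarith)]; linarith [ht.1]
            · rw [max_eq_left (by linarith), max_eq_right (by linarith)]; linarith [ht.2]
          have h2 := mul_le_mul_of_nonneg_left h1 (hκ0 q)
          simp only [ha, hb]
          linarith
        refine hfar ((a q t + b q t) • γ q)
          (Or.inl ⟨(a q t + b q t, q), ⟨⟨by linarith, hab⟩, hqA⟩, rfl⟩) _ ?_
        have e : H q t - (a q t + b q t) • γ q = b q t • ((q : X) - γ q) := by
          simp only [hH]; module
        rw [dist_eq_norm, e, norm_smul, Real.norm_of_nonneg hb0, ← dist_eq_norm, dist_comm]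
        exact (mul_le_of_le_one_left dist_nonneg (by linarith)).trans_lt hd
    · have e : γ q = q := hγ.1 q ⟨hq, hqW⟩
      have hk : κ q = 0 := by simp [hκ, e]
      have : H q t = q := by
        simp only [hH, ha, hb, hk, e]
        module
      rw [this]
      intro hqT
      have : (q : X) ∈ bQ ∩ T := ⟨hq, hqT⟩
      rw [h.boundary_inter] at this
      exact this
  -- `B` collects the points whose path meets `T`; the deformation is switched off there.
  set B : Set Q := Prod.fst '' {z : Q × unitInterval | H z.1 z.2 ∈ T} with hB
  have hBc : IsClosed B := by
    have h1 : IsClosed {z : Q × unitInterval | H z.1 z.2 ∈ T} :=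
      h.isClosed_right.preimage (hHc.comp
        (continuous_fst.prodMk (continuous_subtype_val.comp continuous_snd)))
    exact (h1.isCompact.image continuous_fst).isClosed
  have hbc : IsClosed {q : Q | (q : X) ∈ bQ} :=
    h.isClosed_boundary.preimage continuous_subtype_val
  have hBb : Disjoint B {q : Q | (q : X) ∈ bQ} := by
    rw [Set.disjoint_left]
    rintro _ ⟨⟨q, t⟩, hz, rfl⟩ hq
    exact hHT q hq t t.2 hz
  obtain ⟨φ, hφB, hφb, hφ⟩ := exists_continuous_zero_one_of_isClosed hBc hbc hBb
  obtain ⟨_, ⟨q, rfl⟩, hq⟩ := h.meets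
    ⟨fun q => H q (φ q), hHc.comp (continuous_id.prodMk φ.continuous)⟩ (fun q hq => by
      have h1 : φ q = 1 := hφb hq
      simp only [ContinuousMap.coe_mk, hH, ha, hb, h1]
      norm_num)
  have hqB : q ∈ B := ⟨(q, ⟨φ q, hφ q⟩), hq, rfl⟩
  refine ⟨q, ?_⟩
  have h0 : φ q = 0 := hφB hqB
  have e : H q (φ q) = γ q := by
    simp only [hH, ha, hb, h0]
    norm_num
  rw [← e]
  exact hq

/-! ### A complete metric adapted to the weight `1 + ‖x‖` -/

/-- A closed embedding of `X` into `ℝ × X` whose displacement is, to first order, at most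
`2 ‖dx‖ / (1 + ‖x‖)`. The induced metric on `X` is complete, and turns Ekeland's principle into a
source of Cerami sequences instead of Palais–Smale sequences. -/
def ceramiChart (x : X) : ℝ × X := (Real.log (1 + ‖x‖), (1 + ‖x‖)⁻¹ • x)

/-- A continuous left inverse of `ceramiChart`, defined on all of `ℝ × X`. -/
def ceramiChartInv (z : ℝ × X) : X := Real.exp z.1 • z.2

lemma continuous_ceramiChart : Continuous (ceramiChart : X → ℝ × X) := by
  have h : ∀ x : X, 1 + ‖x‖ ≠ 0 := fun x => by positivity
  unfold ceramiChart
  fun_prop (disch := assumption)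

lemma continuous_ceramiChartInv : Continuous (ceramiChartInv : ℝ × X → X) := by
  unfold ceramiChartInv
  fun_prop

lemma ceramiChartInv_ceramiChart (x : X) : ceramiChartInv (ceramiChart x) = x := by
  have h : 0 < 1 + ‖x‖ := by positivity
  rw [ceramiChart, ceramiChartInv, Real.exp_log h, smul_inv_smul₀ h.ne']

lemma dist_ceramiChart_le {x y : X} {τ : ℝ} (hτ : τ ≤ 1 / 2) (h : ‖y - x‖ ≤ τ * (1 + ‖x‖)) :
    dist (ceramiChart y) (ceramiChart x) ≤ 2 * τ := by
  have hx : 0 < 1 + ‖x‖ := by positivity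
  have hy : 0 < 1 + ‖y‖ := by positivity
  have hτ0 : 0 ≤ τ := nonneg_of_mul_nonneg_left ((norm_nonneg _).trans h) hx
  have hn := (abs_norm_sub_norm_le y x).trans h
  have hn' := abs_le.1 hn
  rw [Prod.dist_eq]
  refine max_le ?_ ?_
  · have h1 : (1 + ‖y‖) / (1 + ‖x‖) ≤ 1 + τ := by
      rw [div_le_iff₀ hx]; linarith [hn'.2]
    have h2 : (1 + ‖x‖) / (1 + ‖y‖) ≤ 1 + 2 * τ := by
      rw [div_le_iff₀ hy]
      have : (1 - τ) * (1 + ‖x‖) ≤ 1 + ‖y‖ := by linarith [hn'.1]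
      have h3 : (1 + 2 * τ) * ((1 - τ) * (1 + ‖x‖)) ≤ (1 + 2 * τ) * (1 + ‖y‖) := by gcongr
      have h4 : 0 ≤ τ * (1 - 2 * τ) * (1 + ‖x‖) := by
        have : 0 ≤ 1 - 2 * τ := by linarith
        positivity
      nlinarith
    rw [Real.dist_eq, abs_le]
    simp only [ceramiChart]
    constructor
    · rw [neg_le, neg_sub, ← Real.log_div hx.ne' hy.ne']
      linarith [Real.log_le_sub_one_of_pos (div_pos hx hy)]
    · rw [← Real.log_div hy.ne' hx.ne']
      linarith [Real.log_le_sub_one_of_pos (div_pos hy hx)]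
  · have e : (1 + ‖y‖)⁻¹ • y - (1 + ‖x‖)⁻¹ • x =
        (1 + ‖x‖)⁻¹ • ((y - x) + ((‖x‖ - ‖y‖) * (1 + ‖y‖)⁻¹) • y) := by
      have : (1 + ‖y‖)⁻¹ = (1 + ‖x‖)⁻¹ * (1 + (‖x‖ - ‖y‖) * (1 + ‖y‖)⁻¹) := by
        field_simp; ring
      nth_rewrite 1 [this]
      module
    simp only [ceramiChart]
    rw [dist_eq_norm, e, norm_smul, norm_inv, Real.norm_of_nonneg hx.le, inv_mul_le_iff₀ hx]
    have h1 : ‖((‖x‖ - ‖y‖) * (1 + ‖y‖)⁻¹) • y‖ ≤ τ * (1 + ‖x‖) := by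
      rw [norm_smul, norm_mul, norm_inv, Real.norm_of_nonneg hy.le, mul_assoc, Real.norm_eq_abs,
        abs_sub_comm]
      refine (mul_le_of_le_one_right (abs_nonneg _) ?_).trans hn
      rw [inv_mul_le_iff₀ hy]
      linarith
    linarith [norm_add_le (y - x) (((‖x‖ - ‖y‖) * (1 + ‖y‖)⁻¹) • y)]

/-! ### Neighbourhoods of a convex set -/

lemma isClosed_coneNhd {E : Type*} [NormedAddCommGroup E] (P : Set E) (μ : ℝ) :
    IsClosed (coneNhd P μ) :=
  isClosed_le (Metric.continuous_infDist_pt P) continuous_const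

lemma subset_coneNhd {E : Type*} [NormedAddCommGroup E] (P : Set E) {μ : ℝ} (hμ : 0 ≤ μ) :
    P ⊆ coneNhd P μ := fun x hx => by
  change Metric.infDist x P ≤ μ
  rwa [Metric.infDist_zero_of_mem hx]

lemma convex_coneNhd {P : Set X} (hP : Convex ℝ P) (hne : P.Nonempty) {μ : ℝ} (hμ : 0 ≤ μ) :
    Convex ℝ (coneNhd P μ) := by
  have : coneNhd P μ = Metric.cthickening μ P := by
    ext x
    exact (ENNReal.le_ofReal_iff_toReal_le (Metric.infEDist_ne_top hne) hμ).symm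
  rw [this]
  exact hP.cthickening μ

lemma coneNhd_subset_interior {E : Type*} [NormedAddCommGroup E] (P : Set E) {μ ν : ℝ}
    (h : μ < ν) :
    coneNhd P μ ⊆ interior (coneNhd P ν) := fun _ hx =>
  mem_interior.2 ⟨{y | Metric.infDist y P < ν},
    fun y (hy : Metric.infDist y P < ν) => show Metric.infDist y P ≤ ν from hy.le,
    isOpen_lt (Metric.continuous_infDist_pt P) continuous_const, lt_of_le_of_lt hx h⟩

/-! ### Descent directions -/

/-- The directions `v` such that `x` moves into the interior of `D` along `-v`. -/
def inwardDirections (D : Set X) (x : X) : Set X :=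
  {v | ∀ᶠ s : ℝ in 𝓝[>] 0, x - s • v ∈ interior D}

lemma convex_inwardDirections {D : Set X} (hD : Convex ℝ D) (x : X) :
    Convex ℝ (inwardDirections D x) := by
  intro v hv w hw a b ha hb hab
  change ∀ᶠ s : ℝ in 𝓝[>] 0, x - s • (a • v + b • w) ∈ interior D
  filter_upwards [show ∀ᶠ s : ℝ in 𝓝[>] 0, x - s • v ∈ interior D from hv,
    show ∀ᶠ s : ℝ in 𝓝[>] 0, x - s • w ∈ interior D from hw] with s h1 h2
  have e : x - s • (a • v + b • w) = a • (x - s • v) + b • (x - s • w) := by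
    have : x = (a + b) • x := by rw [hab, one_smul]
    nth_rewrite 1 [this]
    module
  rw [e]
  exact hD.interior h1 h2 ha hb hab

lemma smul_mem_inwardDirections {D : Set X} (hD : Convex ℝ D) {x y : X} (hx : x ∈ D)
    (hxy : x - y ∈ interior D) {c : ℝ} (hc : 0 < c) : c • y ∈ inwardDirections D x := by
  change ∀ᶠ s : ℝ in 𝓝[>] 0, x - s • c • y ∈ interior D
  filter_upwards [Ioc_mem_nhdsGT (inv_pos.2 hc)] with s hs
  have h1 : s * c ≤ 1 := by
    have := mul_le_mul_of_nonneg_right hs.2 hc.le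
    rwa [inv_mul_cancel₀ hc.ne'] at this
  have e : x - s • c • y = (1 - s * c) • x + (s * c) • (x - y) := by module
  rw [e]
  exact hD.combo_self_interior_mem_interior hx hxy (by linarith) (mul_pos hs.1 hc) (by ring)

/-- If all subgradients at `x` are large, a single direction of controlled length decreases `J` at
the corresponding rate and points into each of the convex sets `D ∋ x` in `𝒟`. Pointing into `D`
is possible for every subgradient separately, by way of the duality map; convexity allows to choose
one direction for all subgradients. -/
lemma LocallyLipschitz.exists_descent_direction {J : X → ℝ} (hJ : LocallyLipschitz J)
    (hX : IsReflexiveSpace X) {𝒟 : Set (Set X)} (hD : ∀ D ∈ 𝒟, Convex ℝ D) {x : X}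
    (hin : ∀ D ∈ 𝒟, x ∈ D → ∀ y ∈ setGradient J x, x - y ∈ interior D) {c : ℝ} (hc : 0 ≤ c)
    (hf : ∀ f ∈ clarkeSubdifferential J x, c < (1 + ‖x‖) * ‖f‖) :
    ∃ v : X, ‖v‖ ≤ 1 + ‖x‖ ∧ (∀ D ∈ 𝒟, x ∈ D → v ∈ inwardDirections D x) ∧
      clarkeDeriv J x (-v) < -c := by
  set C : Set X := {v | ‖v‖ ≤ 1 + ‖x‖ ∧ ∀ D ∈ 𝒟, x ∈ D → v ∈ inwardDirections D x} with hC
  have hCc : Convex ℝ C := by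
    intro v hv w hw a b ha hb hab
    refine ⟨?_, fun D hDD hx =>
      convex_inwardDirections (hD D hDD) x (hv.2 D hDD hx) (hw.2 D hDD hx) ha hb hab⟩
    have := convex_closedBall (0 : X) (1 + ‖x‖) (mem_closedBall_zero_iff.2 hv.1)
      (mem_closedBall_zero_iff.2 hw.1) ha hb hab
    exact mem_closedBall_zero_iff.1 this
  have hsteep : ∀ f ∈ clarkeSubdifferential J x, ∃ v ∈ C, c < f v := by
    intro f hfx
    obtain ⟨y, hy1, hy2⟩ := hX.dualityMap_nonempty f
    have hx1 : 0 < 1 + ‖x‖ := by positivity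
    have hf0 : 0 < ‖f‖ := pos_of_mul_pos_right (hc.trans_lt (hf f hfx)) hx1.le
    have hyn : ‖y‖ = ‖f‖ :=
      ((sq_eq_sq₀ (norm_nonneg f) (norm_nonneg y)).1 hy2).symm
    refine ⟨((1 + ‖x‖) / ‖f‖) • y, ⟨?_, fun D hDD hx => ?_⟩, ?_⟩
    · rw [norm_smul, hyn, Real.norm_of_nonneg (by positivity), div_mul_cancel₀ _ hf0.ne']
    · exact smul_mem_inwardDirections (hD D hDD) hx
        (hin D hDD hx y (mem_biUnion hfx ⟨hy1, hy2⟩)) (by positivity)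
    · rw [map_smul, hy1, smul_eq_mul]
      calc c < (1 + ‖x‖) * ‖f‖ := hf f hfx
        _ = (1 + ‖x‖) / ‖f‖ * ‖f‖ ^ 2 := by field_simp
  by_contra! hcon
  have hCne : C.Nonempty := by
    obtain ⟨f, hfx⟩ := hJ.clarkeSubdifferential_nonempty x
    obtain ⟨v, hv, -⟩ := hsteep f hfx
    exact ⟨v, hv⟩
  obtain ⟨f, hfx, hfC⟩ := hJ.exists_mem_clarkeSubdifferential x hCc.neg hCne.neg (c := -c)
    (fun v hv => by simpa using hcon (-v) hv.1 hv.2)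
  obtain ⟨v, hv, hfv⟩ := hsteep f hfx
  have := hfC (-v) (by simpa using hv)
  rw [map_neg] at this
  linarith

lemma eventually_sub_smul_mem {D : Set X} (hD : Convex ℝ D) (hDc : IsClosed D) {x v : X}
    (hv : x ∈ D → v ∈ inwardDirections D x) :
    ∀ᶠ p : X × ℝ in 𝓝 x ×ˢ 𝓝[>] 0, p.1 ∈ D → p.1 - p.2 • v ∈ D := by
  by_cases hx : x ∈ D
  · have hvx : ∀ᶠ s : ℝ in 𝓝[>] 0, x - s • v ∈ interior D := hv hx
    obtain ⟨s, hs, hs0⟩ := (hvx.and self_mem_nhdsWithin).exists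
    have hs0 : 0 < s := hs0
    have h1 : ∀ᶠ z in 𝓝 x, z - s • v ∈ interior D :=
      (Continuous.tendsto (by fun_prop : Continuous fun z : X => z - s • v) x).eventually
        (isOpen_interior.mem_nhds hs)
    filter_upwards [h1.prod_mk (Ioc_mem_nhdsGT hs0)] with p hp hpD
    have h2 : p.2 / s ≤ 1 := (div_le_one hs0).2 hp.2.2
    have e : p.1 - p.2 • v = (1 - p.2 / s) • p.1 + (p.2 / s) • (p.1 - s • v) := by
      have : (p.2 / s) • s • v = p.2 • v := by rw [smul_smul, div_mul_cancel₀ _ hs0.ne']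
      rw [smul_sub, this]
      module
    rw [e]
    exact hD hpD (interior_subset hp.1) (by linarith) (div_nonneg hp.2.1.le hs0.le) (by ring)
  · filter_upwards [tendsto_fst.eventually (hDc.isOpen_compl.mem_nhds hx)] with p hp hpD
    exact absurd hpD hp

/-- The direction `v` is admissible for a descent step of length up to `ρ` from every point of the
ball of radius `2 ρ` about `x`: it decreases `J` at rate `c` and preserves the sets in `𝒟`. -/
structure IsUniformDescent (J : X → ℝ) (𝒟 : Set (Set X)) (α c : ℝ) (x v : X) (ρ : ℝ) : Prop where
  pos : 0 < ρ
  level : ∀ z ∈ Metric.ball x (2 * ρ), α < J z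
  norm_le : ∀ z ∈ Metric.ball x (2 * ρ), ‖v‖ ≤ 2 * (1 + ‖z‖)
  decrease : ∀ z ∈ Metric.ball x (2 * ρ), ∀ s ∈ Icc 0 ρ, J (z - s • v) ≤ J z - c * s
  invariant : ∀ z ∈ Metric.ball x (2 * ρ), ∀ s ∈ Icc 0 ρ, ∀ D ∈ 𝒟, z ∈ D → z - s • v ∈ D

lemma LocallyLipschitz.exists_isUniformDescent {J : X → ℝ} (hJ : LocallyLipschitz J)
    {𝒟 : Set (Set X)} (hfin : 𝒟.Finite) (hD : ∀ D ∈ 𝒟, Convex ℝ D)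
    (hDc : ∀ D ∈ 𝒟, IsClosed D) {x v : X} {α c : ℝ} (hx : α < J x) (hv : ‖v‖ ≤ 1 + ‖x‖)
    (hin : ∀ D ∈ 𝒟, x ∈ D → v ∈ inwardDirections D x) (hc : clarkeDeriv J x (-v) < -c) :
    ∃ ρ, IsUniformDescent J 𝒟 α c x v ρ := by
  have h1 : ∀ᶠ z in 𝓝 x, α < J z := hJ.continuous.continuousAt.eventually_const_lt hx
  have h2 : ∀ᶠ z in 𝓝 x, ‖v‖ < 2 * (1 + ‖z‖) :=
    (Continuous.tendsto (by fun_prop : Continuous fun z : X => 2 * (1 + ‖z‖)) x).eventually_const_lt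
      (by linarith [norm_nonneg x])
  have h3 : ∀ᶠ p : X × ℝ in 𝓝 x ×ˢ 𝓝[>] 0, ∀ D ∈ 𝒟, p.1 ∈ D → p.1 - p.2 • v ∈ D :=
    (hfin.eventually_all).2 fun D h => eventually_sub_smul_mem (hD D h) (hDc D h) (hin D h)
  obtain ⟨U, hU, V, hV, hUV⟩ := eventually_prod_iff.1 (h3.and (hJ.eventually_diffQuot_lt hc))
  obtain ⟨r, hr, hrU⟩ := Metric.eventually_nhds_iff_ball.1 ((h1.and h2).and hU)
  obtain ⟨b, hb, hbV⟩ := mem_nhdsGT_iff_exists_Ioc_subset.1 hV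
  have hb : 0 < b := hb
  have hρ : 0 < min (r / 2) b := by positivity
  have hball : ∀ z ∈ Metric.ball x (2 * min (r / 2) b), z ∈ Metric.ball x r := fun z hz =>
    Metric.ball_subset_ball (by linarith [min_le_left (r / 2) b]) hz
  have hboth : ∀ z ∈ Metric.ball x (2 * min (r / 2) b), ∀ s ∈ Icc 0 (min (r / 2) b),
      J (z - s • v) ≤ J z - c * s ∧ ∀ D ∈ 𝒟, z ∈ D → z - s • v ∈ D := by
    intro z hz s hs
    rcases hs.1.eq_or_lt with rfl | hs0
    · simp
    obtain ⟨h4, h5⟩ := hUV (hrU z (hball z hz)).2 (hbV ⟨hs0, hs.2.trans (min_le_right _ _)⟩)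
    refine ⟨?_, h4⟩
    simp only at h5
    rw [div_lt_iff₀ hs0, smul_neg, ← sub_eq_add_neg] at h5
    linarith
  exact ⟨min (r / 2) b, hρ, fun z hz => (hrU z (hball z hz)).1.1,
    fun z hz => (hrU z (hball z hz)).1.2.le, fun z hz s hs => (hboth z hz s hs).1,
    fun z hz s hs => (hboth z hz s hs).2⟩

/-! ### The deformation step -/

/-- A combination of descent steps with weights `w` between `0` and `1` decreases `J` at the
combined rate and preserves the sets in `𝒟`. The steps are carried out one after the other, all of
them within the balls on which they are admissible. -/
lemma descent_sum {J : X → ℝ} {𝒟 : Set (Set X)} {α c s : ℝ} {t : Finset X} {v : X → X}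
    {ρ w : X → ℝ} (hdesc : ∀ x ∈ t, IsUniformDescent J 𝒟 α c x (v x) (ρ x)) (hs : 0 ≤ s)
    (hsρ : ∀ x ∈ t, s * (1 + ∑ y ∈ t, ‖v y‖) ≤ ρ x) {z : X}
    (hw0 : ∀ x ∈ t, 0 ≤ w x) (hw1 : ∀ x ∈ t, w x ≤ 1)
    (hwz : ∀ x ∈ t, w x ≠ 0 → dist z x < ρ x) (t' : Finset X) (ht' : t' ⊆ t) :
    J (z - ∑ x ∈ t', (s * w x) • v x) ≤ J z - c * (s * ∑ x ∈ t', w x) ∧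
      ∀ D ∈ 𝒟, z ∈ D → z - ∑ x ∈ t', (s * w x) • v x ∈ D := by
  classical
  induction t' using Finset.induction_on with
  | empty => simp
  | insert x t' hx ih =>
    obtain ⟨ih1, ih2⟩ := ih ((Finset.subset_insert _ _).trans ht')
    have hxt : x ∈ t := ht' (Finset.mem_insert_self _ _)
    rw [Finset.sum_insert hx, Finset.sum_insert hx]
    by_cases hwx : w x = 0
    · simpa [hwx] using ⟨ih1, ih2⟩
    have hnorm : ‖∑ y ∈ t', (s * w y) • v y‖ ≤ s * ∑ y ∈ t, ‖v y‖ := by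
      rw [Finset.mul_sum]
      calc ‖∑ y ∈ t', (s * w y) • v y‖ ≤ ∑ y ∈ t', ‖(s * w y) • v y‖ := norm_sum_le _ _
        _ ≤ ∑ y ∈ t', s * ‖v y‖ := by
            refine Finset.sum_le_sum fun y hy => ?_
            have hyt : y ∈ t := ht' (Finset.mem_insert_of_mem hy)
            rw [norm_smul, Real.norm_of_nonneg (mul_nonneg hs (hw0 y hyt))]
            gcongr
            exact mul_le_of_le_one_right hs (hw1 y hyt)
        _ ≤ ∑ y ∈ t, s * ‖v y‖ :=
            Finset.sum_le_sum_of_subset_of_nonneg ((Finset.subset_insert _ _).trans ht')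
              fun y _ _ => mul_nonneg hs (norm_nonneg _)
    have hsx := hsρ x hxt
    have hN : 0 ≤ s * ∑ y ∈ t, ‖v y‖ := mul_nonneg hs (Finset.sum_nonneg fun _ _ => norm_nonneg _)
    have hball : z - ∑ y ∈ t', (s * w y) • v y ∈ Metric.ball x (2 * ρ x) := by
      rw [Metric.mem_ball, dist_eq_norm]
      have e : z - ∑ y ∈ t', (s * w y) • v y - x = (z - x) - ∑ y ∈ t', (s * w y) • v y := by abel
      have h1 := hwz x hxt hwx
      rw [dist_eq_norm] at h1
      rw [e]
      linarith [norm_sub_le (z - x) (∑ y ∈ t', (s * w y) • v y)]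
    have hstep : s * w x ∈ Icc 0 (ρ x) :=
      ⟨mul_nonneg hs (hw0 x hxt), by linarith [mul_le_of_le_one_right hs (hw1 x hxt)]⟩
    have e : z - ((s * w x) • v x + ∑ y ∈ t', (s * w y) • v y) =
        z - ∑ y ∈ t', (s * w y) • v y - (s * w x) • v x := by abel
    rw [e]
    refine ⟨?_, fun D hD hz => (hdesc x hxt).invariant _ hball _ hstep D hD (ih2 D hD hz)⟩
    have := (hdesc x hxt).decrease _ hball _ hstep
    linarith

/-- If uniform descent is possible near all points of height `M` in the closure of `γ(Q) ∖ W`, then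
an admissible map `γ` can be pushed below the level `M` by a small displacement. -/
lemma exists_deformed_map {J : X → ℝ} (hJ : Continuous J) {Q bQ W : Set X} (hQ : IsCompact Q)
    {𝒟 : Set (Set X)} (hW : W = ⋃₀ 𝒟) {α M c : ℝ} (hc : 0 < c)
    (hα : ∀ x ∈ bQ ∩ Wᶜ, J x ≤ α) {γ : C(Q, X)} (hγ : γ ∈ admissibleMaps Q bQ W)
    (hM : ∀ q, γ q ∉ W → J (γ q) ≤ M)
    (hdesc : ∀ x ∈ closure (range γ ∩ Wᶜ), J x = M → ∃ v ρ, IsUniformDescent J 𝒟 α c x v ρ) :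
    ∃ s : ℝ, 0 < s ∧ s ≤ 1 / 4 ∧ ∃ γ' ∈ admissibleMaps Q bQ W,
      (∀ q, γ' q ∉ W → J (γ' q) ≤ M - 9 / 10 * c * s) ∧
      ∀ q, ‖γ' q - γ q‖ ≤ 2 * s * (1 + ‖γ q‖) := by
  have : CompactSpace Q := isCompact_iff_compactSpace.1 hQ
  set A := closure (range γ ∩ Wᶜ) with hA
  have hAc : IsCompact A :=
    (isCompact_range γ.continuous).of_isClosed_subset isClosed_closure
      (closure_minimal inter_subset_left (isCompact_range γ.continuous).isClosed)
  have hAM : ∀ x ∈ A, J x ≤ M := fun x hx =>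
    closure_minimal (t := {x | J x ≤ M}) (by rintro _ ⟨⟨q, rfl⟩, hq⟩; exact hM q hq)
      (isClosed_le hJ continuous_const) hx
  have hA0c : IsCompact (A ∩ {x | J x = M}) :=
    hAc.inter_right (isClosed_eq hJ continuous_const)
  choose! v ρ hvρ using hdesc
  obtain ⟨t, htA, htc⟩ := hA0c.elim_nhds_subcover (fun x => Metric.ball x (ρ x))
    fun x hx => Metric.ball_mem_nhds x (hvρ x hx.1 hx.2).pos
  have ht : ∀ x ∈ t, IsUniformDescent J 𝒟 α c x (v x) (ρ x) := fun x hx =>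
    hvρ x (htA x hx).1 (htA x hx).2
  -- Bump functions, and weights whose sum is at most one everywhere; on the set to be lowered it is
  -- at least `20 / 21`, hence greater than `9 / 10` on a neighbourhood of that set.
  set ψ : X → X → ℝ := fun x z => max 0 (ρ x - dist z x) with hψ
  have hψ0 : ∀ x z, 0 ≤ ψ x z := fun x z => le_max_left _ _
  have hψρ : ∀ x z, ψ x z ≠ 0 → dist z x < ρ x := fun x z h => by
    by_contra! hcon
    exact h (max_eq_left (by linarith))
  set G : X → ℝ := fun z => ∑ x ∈ t, ψ x z with hG
  have hG0 : ∀ z, 0 ≤ G z := fun z => Finset.sum_nonneg fun x _ => hψ0 x z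
  have hψc : ∀ x, Continuous (ψ x) := fun x => by fun_prop
  have hGc : Continuous G := continuous_finsetSum _ fun x _ => hψc x
  obtain ⟨σ, hσ, hGσ⟩ := hA0c.exists_forall_le' hGc.continuousOn (a := 0) fun z hz => by
    obtain ⟨x, hx, hzx⟩ := mem_iUnion₂.1 (htc hz)
    exact Finset.sum_pos' (fun x _ => hψ0 x z)
      ⟨x, hx, lt_max_of_lt_right (sub_pos.2 hzx)⟩
  have hden : ∀ z, 0 < σ / 20 + G z := fun z => by linarith [hG0 z]
  set w : X → X → ℝ := fun x z => ψ x z / (σ / 20 + G z) with hw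
  have hw0 : ∀ x z, 0 ≤ w x z := fun x z => div_nonneg (hψ0 x z) (hden z).le
  have hwc : ∀ x, Continuous (w x) := fun x =>
    (hψc x).div (by fun_prop) fun z => (hden z).ne'
  have hwsum : ∀ z, ∑ x ∈ t, w x z = G z / (σ / 20 + G z) := fun z => by
    rw [hG, Finset.sum_div]
  have hwsum1 : ∀ z, ∑ x ∈ t, w x z ≤ 1 := fun z => by
    rw [hwsum, div_le_one (hden z)]; linarith
  have hw1 : ∀ z, ∀ x ∈ t, w x z ≤ 1 := fun z x hx =>
    (Finset.single_le_sum (f := fun x => w x z) (fun x _ => hw0 x z) hx).trans (hwsum1 z)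
  have hwρ : ∀ x z, w x z ≠ 0 → dist z x < ρ x := fun x z h =>
    hψρ x z fun h0 => h (by simp [hw, h0])
  have hwball : ∀ x ∈ t, ∀ z, w x z ≠ 0 → z ∈ Metric.ball x (2 * ρ x) := fun x hx z h =>
    Metric.ball_subset_ball (by linarith [(ht x hx).pos]) (hwρ x z h)
  -- Where the weights are small, `J` stays below a bound smaller than `M`, by compactness.
  have hA2c : IsCompact (A ∩ {z | ∑ x ∈ t, w x z ≤ 9 / 10}) :=
    hAc.inter_right (isClosed_le (continuous_finsetSum _ fun x _ => hwc x) continuous_const)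
  obtain ⟨θ, hθ, hJθ⟩ := hA2c.exists_forall_le' (f := fun z => M - J z) (a := 0)
      (continuous_const.sub hJ).continuousOn fun z hz => by
    refine sub_pos.2 (lt_of_le_of_ne (hAM z hz.1) fun h => ?_)
    have h1 := hGσ z ⟨hz.1, h⟩
    have h2 : ∑ x ∈ t, w x z ≤ 9 / 10 := hz.2
    rw [hwsum, div_le_iff₀ (hden z)] at h2
    linarith
  set N := ∑ y ∈ t, ‖v y‖ with hN
  have hN0 : 0 ≤ N := Finset.sum_nonneg fun _ _ => norm_nonneg _
  obtain ⟨s, ⟨⟨hs0, hs4⟩, hsM⟩, hsρ⟩ : ∃ s : ℝ, (s ∈ Ioc 0 (1 / 4) ∧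
      s ∈ Ioc 0 (θ / (9 / 10 * c))) ∧ ∀ x ∈ t, s ∈ Ioc 0 (ρ x / (1 + N)) := by
    have h1 : ∀ᶠ s : ℝ in 𝓝[>] 0, ∀ x ∈ t, s ∈ Ioc 0 (ρ x / (1 + N)) :=
      (Finset.eventually_all t).2 fun x hx =>
        Ioc_mem_nhdsGT (div_pos (ht x hx).pos (by linarith))
    have h2 : 0 < θ / (9 / 10 * c) := div_pos hθ (by positivity)
    have h3 : (0 : ℝ) < 1 / 4 := by norm_num
    have h4 : ∀ᶠ s : ℝ in 𝓝[>] 0, s ∈ Ioc 0 (1 / 4) := Ioc_mem_nhdsGT h3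
    exact ((h4.and (Ioc_mem_nhdsGT h2)).and h1).exists
  have hsρ' : ∀ x ∈ t, s * (1 + N) ≤ ρ x := fun x hx =>
    (le_div_iff₀ (by linarith)).1 (hsρ x hx).2
  set m : X → X := fun z => ∑ x ∈ t, (s * w x z) • v x with hm
  have hmc : Continuous m :=
    continuous_finsetSum _ fun x _ => (continuous_const.mul (hwc x)).smul continuous_const
  have hmJ : ∀ z, J (z - m z) ≤ J z - c * (s * ∑ x ∈ t, w x z) ∧ ∀ D ∈ 𝒟, z ∈ D → z - m z ∈ D :=
    fun z => descent_sum ht hs0.le hsρ' (fun x _ => hw0 x z) (hw1 z) (fun x _ => hwρ x z) t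
      Finset.Subset.rfl
  have hmW : ∀ z ∈ W, z - m z ∈ W := fun z hz => by
    rw [hW] at hz ⊢
    obtain ⟨D, hD, hzD⟩ := hz
    exact ⟨D, hD, (hmJ z).2 D hD hzD⟩
  refine ⟨s, hs0, hs4, ⟨fun q => γ q - m (γ q), by fun_prop⟩, ⟨fun q hq => ?_, fun q hq => ?_⟩,
    fun q hq => ?_, fun q => ?_⟩
  · have h1 : γ q = q := hγ.1 q hq
    have h2 : m (γ q) = 0 := Finset.sum_eq_zero fun x hx => by
      by_cases h3 : w x (γ q) = 0
      · simp [h3]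
      · have h4 := (ht x hx).level _ (hwball x hx _ h3)
        rw [h1] at h4
        exact absurd (hα _ hq) (not_le.2 h4)
    change γ q - m (γ q) = q
    rw [h2, h1, sub_zero]
  · exact hmW _ (hγ.2 q hq)
  · have hqW : γ q ∉ W := fun h => hq (hmW _ h)
    have hqA : γ q ∈ A := subset_closure ⟨mem_range_self q, hqW⟩
    have h1 := (hmJ (γ q)).1
    have hcs : 0 < c * s := by positivity
    change J (γ q - m (γ q)) ≤ _
    rcases le_or_gt (∑ x ∈ t, w x (γ q)) (9 / 10) with h2 | h2
    · have h3 := hJθ _ ⟨hqA, h2⟩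
      have h4 := hsM.2
      rw [le_div_iff₀ (by positivity)] at h4
      have h5 : 0 ≤ c * (s * ∑ x ∈ t, w x (γ q)) :=
        mul_nonneg hc.le (mul_nonneg hs0.le (Finset.sum_nonneg fun x _ => hw0 x _))
      linarith
    · have := mul_lt_mul_of_pos_left h2 hcs
      linarith [hAM _ hqA]
  · have e : γ q - m (γ q) - γ q = -m (γ q) := by abel
    change ‖γ q - m (γ q) - γ q‖ ≤ _
    rw [e, norm_neg]
    calc ‖m (γ q)‖ ≤ ∑ x ∈ t, ‖(s * w x (γ q)) • v x‖ := norm_sum_le _ _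
      _ ≤ ∑ x ∈ t, w x (γ q) * (2 * s * (1 + ‖γ q‖)) := by
          refine Finset.sum_le_sum fun x hx => ?_
          rw [norm_smul, Real.norm_of_nonneg (mul_nonneg hs0.le (hw0 _ _))]
          by_cases h3 : w x (γ q) = 0
          · simp [h3]
          · have := mul_le_mul_of_nonneg_left ((ht x hx).norm_le _ (hwball x hx _ h3))
              (mul_nonneg hs0.le (hw0 x (γ q)))
            linarith
      _ = (∑ x ∈ t, w x (γ q)) * (2 * s * (1 + ‖γ q‖)) := by rw [Finset.sum_mul]
      _ ≤ 1 * (2 * s * (1 + ‖γ q‖)) := by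
          gcongr
          exact hwsum1 _
      _ = _ := one_mul _

/-! ### The minimax level -/

lemma isClosed_admissibleMaps {E : Type*} [NormedAddCommGroup E] {Q bQ W : Set E}
    (hW : IsClosed W) :
    IsClosed (admissibleMaps Q bQ W) := by
  have e : admissibleMaps Q bQ W =
      (⋂ q : Q, ⋂ _ : (q : E) ∈ bQ ∩ Wᶜ, {γ : C(Q, E) | γ q = q}) ∩
        ⋂ q : Q, ⋂ _ : (q : E) ∈ bQ ∩ W, {γ : C(Q, E) | γ q ∈ W} := by
    ext γ
    simp only [admissibleMaps, mem_inter_iff, mem_iInter, mem_ofPred_eq]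
  rw [e]
  refine (isClosed_iInter fun q => isClosed_iInter fun _ => ?_).inter
    (isClosed_iInter fun q => isClosed_iInter fun _ => ?_)
  · exact isClosed_eq (ContinuousEvalConst.continuous_eval_const q) continuous_const
  · exact hW.preimage (ContinuousEvalConst.continuous_eval_const q)

/-- Almost critical points, in the sense of Cerami, close to the minimax level `r` and outside the
interior of `W`. An almost minimizing map is improved by Ekeland's principle in the metric given by
`ceramiChart`; if it had no almost critical point at its top level, `exists_deformed_map` would
contradict its almost minimality. -/
lemma LocallyLipschitz.exists_almost_critical [CompleteSpace X] (hX : IsReflexiveSpace X)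
    {J : X → ℝ} (hJ : LocallyLipschitz J) {Q bQ W : Set X} (hQ : IsCompact Q)
    {𝒟 : Set (Set X)} (hfin : 𝒟.Finite) (hD : ∀ D ∈ 𝒟, Convex ℝ D) (hDc : ∀ D ∈ 𝒟, IsClosed D)
    (hW : W = ⋃₀ 𝒟)
    (hin : ∀ D ∈ 𝒟, ∀ x ∈ frontier D, ∀ y ∈ setGradient J x, x - y ∈ interior D)
    {α r : ℝ} (hα : ∀ x ∈ bQ ∩ Wᶜ, J x ≤ α) (hαr : α < r)
    (hne : ∀ γ ∈ admissibleMaps Q bQ W, ∃ q, γ q ∉ W)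
    (hr : ∀ γ ∈ admissibleMaps Q bQ W, ∀ c, (∀ q, γ q ∉ W → J (γ q) ≤ c) → r ≤ c)
    {ε : ℝ} (hε : 0 < ε)
    (hrε : ∃ γ ∈ admissibleMaps Q bQ W, ∀ q, γ q ∉ W → J (γ q) ≤ r + ε) :
    ∃ x ∈ closure Wᶜ, J x ∈ Icc r (r + ε) ∧
      ∃ f ∈ clarkeSubdifferential J x, (1 + ‖x‖) * ‖f‖ ≤ 5 * ε := by
  have : CompactSpace Q := isCompact_iff_compactSpace.1 hQ
  have hWc : IsClosed W := by rw [hW, sUnion_eq_biUnion]; exact hfin.isClosed_biUnion hDc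
  set Φ : C(Q, X) → ℝ := fun γ => sSup (J '' (range γ ∩ Wᶜ)) with hΦ
  have hbdd : ∀ γ : C(Q, X), BddAbove (J '' (range γ ∩ Wᶜ)) := fun γ =>
    ((isCompact_range γ.continuous).image hJ.continuous).bddAbove.mono
      (image_mono inter_subset_left)
  have hle : ∀ (γ : C(Q, X)) (q : Q), γ q ∉ W → J (γ q) ≤ Φ γ := fun γ q hq =>
    le_csSup (hbdd γ) ⟨_, ⟨mem_range_self q, hq⟩, rfl⟩
  have hnonempty : ∀ γ ∈ admissibleMaps Q bQ W, (J '' (range γ ∩ Wᶜ)).Nonempty := fun γ hγ => by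
    obtain ⟨q, hq⟩ := hne γ hγ
    exact ⟨_, _, ⟨mem_range_self q, hq⟩, rfl⟩
  have hΦle : ∀ γ ∈ admissibleMaps Q bQ W, ∀ c, (∀ q, γ q ∉ W → J (γ q) ≤ c) → Φ γ ≤ c := by
    intro γ hγ c hc
    refine csSup_le (hnonempty γ hγ) ?_
    rintro _ ⟨_, ⟨⟨q, rfl⟩, hq⟩, rfl⟩
    exact hc q hq
  -- The admissible maps, with the metric transported from `C(Q, ℝ × X)`.
  set push : C(Q, X) → C(Q, ℝ × X) := fun γ =>
    (⟨ceramiChart, continuous_ceramiChart⟩ : C(X, ℝ × X)).comp γ with hpush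
  set pull : C(Q, ℝ × X) → C(Q, X) := fun k =>
    (⟨ceramiChartInv, continuous_ceramiChartInv⟩ : C(ℝ × X, X)).comp k with hpull
  have hpushc : Continuous push := ContinuousMap.continuous_postcomp _
  have hpullc : Continuous pull := ContinuousMap.continuous_postcomp _
  have hpp : ∀ γ, pull (push γ) = γ := fun γ => by
    ext q; exact ceramiChartInv_ceramiChart (γ q)
  set Z : Set C(Q, ℝ × X) := {k | push (pull k) = k ∧ pull k ∈ admissibleMaps Q bQ W} with hZ
  have hZc : IsClosed Z := (isClosed_eq (hpushc.comp hpullc) continuous_id).inter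
    ((isClosed_admissibleMaps hWc).preimage hpullc)
  have hpushZ : ∀ γ ∈ admissibleMaps Q bQ W, push γ ∈ Z := fun γ hγ =>
    ⟨by rw [hpp], by rwa [hpp]⟩
  have : CompleteSpace Z := hZc.completeSpace_coe
  have hlsc : LowerSemicontinuous fun k : Z => Φ (pull k) := by
    intro k c hc
    obtain ⟨_, ⟨_, ⟨⟨q, rfl⟩, hq⟩, rfl⟩, hcq⟩ := exists_lt_of_lt_csSup (hnonempty _ k.2.2) hc
    have hcont : Continuous fun k : Z => pull k q :=
      (ContinuousEvalConst.continuous_eval_const q).comp (hpullc.comp continuous_subtype_val)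
    filter_upwards [hcont.continuousAt.eventually (hWc.isOpen_compl.mem_nhds hq),
      (hJ.continuous.comp hcont).continuousAt.eventually_const_lt hcq] with k' h1 h2
    exact lt_of_lt_of_le h2 (hle _ q h1)
  have hrΦ : ∀ k : Z, r ≤ Φ (pull k) := fun k => hr _ k.2.2 _ (hle _)
  obtain ⟨γ₀, hγ₀, hγ₀r⟩ := hrε
  obtain ⟨k, hk0, hk⟩ := hlsc.exists_le_add_mul_dist hrΦ hε ⟨push γ₀, hpushZ γ₀ hγ₀⟩
  have hkr : Φ (pull k) ≤ r + ε := by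
    refine hk0.trans ?_
    simp only [hpp]
    exact hΦle γ₀ hγ₀ _ hγ₀r
  -- Descent at rate `5 * ε` gains `9 / 10 * 5 * ε * s` at the cost of a displacement of at most
  -- `4 * s`, which is more than the slope `ε` in Ekeland's principle allows.
  by_contra! hcon
  have hcl : closure (range (pull k) ∩ Wᶜ) ⊆ closure Wᶜ := closure_mono inter_subset_right
  obtain ⟨s, hs0, hs4, γ', hγ', hJγ', hdist⟩ := exists_deformed_map (c := 5 * ε) (𝒟 := 𝒟)
    hJ.continuous hQ hW (by positivity) hα k.2.2 (hle _) fun x hx hxM => by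
      have hxα : α < J x := by rw [hxM]; exact hαr.trans_le (hrΦ k)
      obtain ⟨v, hv1, hv2, hv3⟩ := hJ.exists_descent_direction hX hD (x := x) (c := 5 * ε)
        (fun D hDD hxD y hy => by
          refine hin D hDD x ⟨subset_closure hxD, fun hxi => ?_⟩ y hy
          have h1 : x ∈ (interior D)ᶜ := by
            have h2 : Wᶜ ⊆ Dᶜ := compl_subset_compl.2 (by rw [hW]; exact subset_sUnion_of_mem hDD)
            rw [← closure_compl]
            exact closure_mono h2 (hcl hx)
          exact h1 hxi)
        (by positivity) (hcon x (hcl hx) (by rw [hxM]; exact ⟨hrΦ k, hkr⟩))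
      obtain ⟨ρ, hρ⟩ := hJ.exists_isUniformDescent hfin hD hDc hxα hv1 hv2 hv3
      exact ⟨v, ρ, hρ⟩
  have h1 := hk ⟨push γ', hpushZ γ' hγ'⟩
  have h2 : dist (⟨push γ', hpushZ γ' hγ'⟩ : Z) k ≤ 4 * s := by
    have e : (k : C(Q, ℝ × X)) = push (pull k) := k.2.1.symm
    rw [Subtype.dist_eq, e]
    refine (ContinuousMap.dist_le (by positivity)).2 fun q => ?_
    have := dist_ceramiChart_le (x := pull k q) (y := γ' q) (τ := 2 * s) (by linarith) (hdist q)
    refine le_trans this (by linarith)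
  have h3 := hΦle γ' hγ' _ hJγ'
  simp only [hpp] at h1
  have h4 := mul_le_mul_of_nonneg_left h2 hε.le
  have h5 : 0 < ε * s := by positivity
  linarith

end

theorem theorem3p1 {X : Type*} [NormedAddCommGroup X] [NormedSpace ℝ X] [CompleteSpace X]
    (hX : IsReflexiveSpace X) (P : Set X) (hP : IsOrderCone P)
    (J : X → ℝ) (hJ : LocallyLipschitz J)
    (μ₀ : ℝ) (hμ₀ : 0 < μ₀) (hμ₁ : μ₀ < 1)
    (H1 : InvarianceCondition P J μ₀) (H2 : CompactnessCondition P J μ₀)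
    (W : Set X) (hW : W = coneNhd P μ₀ ∪ coneNhd (-P) μ₀)
    (Q bQ T : Set X) (hQT : IsLinking Q bQ T) (hQ : IsCompact Q) (hT : T ⊆ Wᶜ)
    (α β : ℝ) (hαβ : α < β) (hα : ∀ x ∈ bQ ∩ Wᶜ, J x ≤ α) (hβ : ∀ x ∈ T, β ≤ J x) :
    ∃ r : ℝ, (r : EReal) = minimaxLevel J Q bQ W ∧ β ≤ r ∧
      ∃ x ∈ Wᶜ, J x = r ∧ IsSignChangingCriticalPoint P J x := by
  have : CompactSpace Q := isCompact_iff_compactSpace.1 hQ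
  have h0P : (0 : X) ∈ P ∩ -P := by rw [hP.inter_neg]; rfl
  set 𝒟 : Set (Set X) := {coneNhd P μ₀, coneNhd (-P) μ₀} with h𝒟
  have hfin : 𝒟.Finite := by simp [h𝒟]
  have hW𝒟 : W = ⋃₀ 𝒟 := by rw [hW, h𝒟, sUnion_pair]
  have hD : ∀ D ∈ 𝒟, Convex ℝ D := by
    rintro D (rfl | rfl)
    · exact convex_coneNhd hP.convex ⟨0, h0P.1⟩ hμ₀.le
    · exact convex_coneNhd hP.convex.neg ⟨0, h0P.2⟩ hμ₀.le
  have hDc : ∀ D ∈ 𝒟, IsClosed D := by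
    rintro D (rfl | rfl) <;> exact isClosed_coneNhd _ _
  have hD0 : ∀ D ∈ 𝒟, (0 : X) ∈ D := by
    rintro D (rfl | rfl)
    · exact subset_coneNhd _ hμ₀.le h0P.1
    · exact subset_coneNhd _ hμ₀.le h0P.2
  have hin : ∀ D ∈ 𝒟, ∀ x ∈ frontier D, ∀ y ∈ setGradient J x, x - y ∈ interior D := by
    rintro D (rfl | rfl) x hx y hy
    · exact coneNhd_subset_interior _ (by linarith) (H1.1 x hx y hy)
    · exact coneNhd_subset_interior _ (by linarith) (H1.2 x hx y hy)
  have hWc : IsClosed W := by rw [hW𝒟, sUnion_eq_biUnion]; exact hfin.isClosed_biUnion hDc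
  have hWs : ∀ x ∈ W, ∀ s ∈ Icc (0 : ℝ) 1, s • x ∈ W := by
    rw [hW𝒟]
    rintro x ⟨D, hDD, hx⟩ s hs
    exact ⟨D, hDD, (hD D hDD).smul_mem_of_zero_mem (hD0 D hDD) hx hs⟩
  have hlink : ∀ γ ∈ admissibleMaps Q bQ W, ∃ q, γ q ∈ T := fun γ hγ =>
    hQT.exists_mem_of_admissible hQ hWc hWs hT hγ
  -- The minimax level is finite: the inclusion of `Q` is admissible.
  have hβr : (β : EReal) ≤ minimaxLevel J Q bQ W := by
    refine le_iInf₂ fun γ hγ => ?_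
    obtain ⟨q, hq⟩ := hlink γ hγ
    exact (EReal.coe_le_coe_iff.2 (hβ _ hq)).trans
      (le_iSup₂ (f := fun x (_ : x ∈ range γ ∩ Wᶜ) => (J x : EReal)) (γ q)
        ⟨mem_range_self q, hT hq⟩)
  have hlt : minimaxLevel J Q bQ W < ⊤ := by
    obtain ⟨c, hc⟩ := (hQ.image hJ.continuous).bddAbove
    refine lt_of_le_of_lt (iInf₂_le (⟨Subtype.val, continuous_subtype_val⟩ : C(Q, X))
      ⟨fun q _ => rfl, fun q hq => hq.2⟩) (lt_of_le_of_lt ?_ (EReal.coe_lt_top c))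
    refine iSup₂_le ?_
    rintro _ ⟨⟨q, rfl⟩, -⟩
    exact EReal.coe_le_coe_iff.2 (hc ⟨q, q.2, rfl⟩)
  set r : ℝ := (minimaxLevel J Q bQ W).toReal with hr
  have hre : (r : EReal) = minimaxLevel J Q bQ W :=
    EReal.coe_toReal hlt.ne ((EReal.bot_lt_coe β).trans_le hβr).ne'
  have hβr' : β ≤ r := by rw [← hre] at hβr; exact EReal.coe_le_coe_iff.1 hβr
  refine ⟨r, hre, hβr', ?_⟩
  have hrle : ∀ γ ∈ admissibleMaps Q bQ W, ∀ c, (∀ q, γ q ∉ W → J (γ q) ≤ c) → r ≤ c := by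
    intro γ hγ c hc
    rw [← EReal.coe_le_coe_iff, hre]
    refine (iInf₂_le γ hγ).trans (iSup₂_le ?_)
    rintro _ ⟨⟨q, rfl⟩, hq⟩
    exact EReal.coe_le_coe_iff.2 (hc q hq)
  have hrlt : ∀ ε : ℝ, 0 < ε →
      ∃ γ ∈ admissibleMaps Q bQ W, ∀ q, γ q ∉ W → J (γ q) ≤ r + ε := by
    intro ε hε
    have h1 : minimaxLevel J Q bQ W < ((r + ε : ℝ) : EReal) := by
      rw [← hre, EReal.coe_lt_coe_iff]; linarith
    obtain ⟨γ, h2⟩ := iInf_lt_iff.1 h1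
    obtain ⟨hγ, h2⟩ := iInf_lt_iff.1 h2
    refine ⟨γ, hγ, fun q hq => EReal.coe_le_coe_iff.1 (le_trans ?_ h2.le)⟩
    exact le_iSup₂ (f := fun x (_ : x ∈ range γ ∩ Wᶜ) => (J x : EReal)) (γ q)
      ⟨mem_range_self q, hq⟩
  -- A Cerami sequence at the level `r`, and its limit.
  have hseq : ∀ n : ℕ, ∃ x ∈ closure Wᶜ, J x ∈ Icc r (r + 1 / ((n : ℝ) + 1)) ∧
      ∃ f ∈ clarkeSubdifferential J x, (1 + ‖x‖) * ‖f‖ ≤ 5 * (1 / ((n : ℝ) + 1)) := fun n =>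
    hJ.exists_almost_critical hX hQ hfin hD hDc hW𝒟 hin hα (hαβ.trans_le hβr')
      (fun γ hγ => (hlink γ hγ).imp fun q hq => hT hq) hrle Nat.one_div_pos_of_nat
      (hrlt _ Nat.one_div_pos_of_nat)
  choose u huW hur f hfu hf5 using hseq
  have hsmall : Tendsto (fun n : ℕ => 5 * (1 / ((n : ℝ) + 1))) atTop (𝓝 0) := by
    simpa using tendsto_one_div_add_atTop_nhds_zero_nat.const_mul (5 : ℝ)
  have hJu : Tendsto (fun n => J (u n)) atTop (𝓝 r) := by
    refine tendsto_of_tendsto_of_tendsto_of_le_of_le tendsto_const_nhds ?_ (fun n => (hur n).1)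
      fun n => (hur n).2
    simpa using tendsto_one_div_add_atTop_nhds_zero_nat.const_add r
  have hslope : Tendsto (fun n => (1 + ‖u n‖) * slopeOn J univ (u n)) atTop (𝓝 0) := by
    refine squeeze_zero (fun n => ?_) (fun n => ?_) hsmall
    · exact mul_nonneg (by positivity) (slopeOn_univ_mem_Icc (hfu n)).1
    · refine le_trans ?_ (hf5 n)
      gcongr
      exact (slopeOn_univ_mem_Icc (hfu n)).2
  have hf0 : Tendsto f atTop (𝓝 0) := by
    refine squeeze_zero_norm (fun n => ?_) hsmall
    refine le_trans ?_ (hf5 n)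
    exact le_mul_of_one_le_left (norm_nonneg _) (by linarith [norm_nonneg (u n)])
  obtain ⟨a, k, hk, ha⟩ := H2.1 r u (fun _ => mem_univ _) hJu hslope
  have hacrit : IsCriticalPoint J a :=
    hJ.isCriticalPoint_of_tendsto ha (fun n => hfu (k n)) (hf0.comp hk.tendsto_atTop)
  have haW : a ∈ closure Wᶜ :=
    isClosed_closure.mem_of_tendsto ha (Eventually.of_forall fun n => huW (k n))
  -- A critical point cannot lie on the frontier of `D ∈ 𝒟`, because `0` is a gradient there.
  have haW' : a ∉ W := by
    rw [hW𝒟]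
    rintro ⟨D, hDD, haD⟩
    have h1 : a ∉ interior D := by
      have h2 : Wᶜ ⊆ Dᶜ := compl_subset_compl.2 (by rw [hW𝒟]; exact subset_sUnion_of_mem hDD)
      have h3 : a ∈ (interior D)ᶜ := by
        rw [← closure_compl]
        exact closure_mono h2 haW
      exact h3
    have h0 : (0 : X) ∈ setGradient J a := mem_biUnion hacrit (by simp [dualityMap])
    exact h1 (by simpa using hin D hDD a ⟨subset_closure haD, h1⟩ 0 h0)
  refine ⟨a, haW', tendsto_nhds_unique ((hJ.continuous.tendsto a).comp ha)
    (hJu.comp hk.tendsto_atTop), hacrit, fun haP => haW' ?_⟩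
  rw [hW]
  exact haP.imp (fun h => subset_coneNhd _ hμ₀.le h) fun h => subset_coneNhd _ hμ₀.le h
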